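/- **Setting.** Let $A$ be a Noetherian normal domain (an integral domain integrally closed in its fraction field) with a good notion of dimension: to every prime $\mathfrak p$ an integer $\dim A/\mathfrak p$ is attached such that $\dim A/\mathfrak p=\dim A/\mathfrak q+1$ whenever $\mathfrak p\subsetneq\mathfrak q$ are primes with no prime strictly between them. Let $Z_*(A)$ be the free abelian group on the prime ideals of $A$, with basis elements $[A/\mathfrak q]$; in particular $[A]$ is the basis element of the zero ideal. For a prime $\mathfrak p$ and $x\in A\setminus\mathfrak p$ put $$\operatorname{div}(\mathfrak p,x)=\sum_{\dim A/\mathfrak q=\dim A/\mathfrak p-1}\ell_{A_{\mathfrak q}}\bigl(A_{\mathfrak q}/(\mathfrak p,x)A_{\mathfrak q}\bigr)\,[A/\mathfrak q],$$ and for $x,y\in A\setminus\mathfrak p$ put $\operatorname{div}(\mathfrak p,x/y)=\operatorname{div}(\mathfrak p,x)-\operatorname{div}(\mathfrak p,y)$. For $u\in A$ let $(u)\cap-$ be the additive map on cycles with $(u)\cap[A/\mathfrak p]=0$ if $u\in\mathfrak p$ and $(u)\cap[A/\mathfrak p]=\operatorname{div}(\mathfrak p,u)$ if $u\notin\mathfrak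 p$. For a height-one prime $\mathfrak p$ let $\nu_{\mathfrak p}$ be the normalized valuation of the discrete valuation ring $A_{\mathfrak p}$. **Theorem 3.1.** Let $u,v\in A$ be nonzero, let $\mathfrak p_1,\dots,\mathfrak p_r$ ($r\ge 0$) be the distinct height-one primes of $A$ containing both $u$ and $v$, and let $n_i=\nu_{\mathfrak p_i}(u)$ and $m_i=\nu_{\mathfrak p_i}(v)$. Suppose that for each $i$ the elements $a_i,b_i\in A\setminus\mathfrak p_i$ satisfy $$\frac{a_i}{b_i}=\frac{v^{n_i}}{u^{m_i}}$$ in the fraction field of $A$. Then there is an equality of cycles $$(u)\cap(v)\cap[A]-(v)\cap(u)\cap[A]=\sum_{i=1}^r\operatorname{div}(\mathfrak p_i,a_i/b_i).$$ -/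

import Mathlib

namespace CycleIntersection

/-- A good dimension theory on `A`: to every prime `p` an integer `dim p`, thought of as the
dimension of `A / p`, is attached, and `dim p = dim q + 1` whenever `p < q` are primes with no
prime strictly between them (this is what `p ⋖ q` says). -/
structure DimensionTheory (A : Type*) [CommRing A] where
  dim : PrimeSpectrum A → ℤ
  dim_of_covBy : ∀ p q : PrimeSpectrum A, p ⋖ q → dim p = dim q + 1

/-- The group `Z_*(A)` of cycles: the free abelian group on the prime ideals of `A`.
For an ideal `I` of `A`, the group `Z_*(A / I)` is identified with the subgroup of the cycles
supported on the primes that contain `I`. -/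
abbrev Cycle (A : Type*) [CommRing A] : Type _ := PrimeSpectrum A →₀ ℤ

section Noetherian

variable {A : Type*} [CommRing A]

/-- The length of the `A_q`-module `A_q / (p, x) A_q`, as an element of `ℕ∞`. -/
noncomputable def localLength (p : PrimeSpectrum A) (x : A) (q : PrimeSpectrum A) : ℕ∞ :=
  Module.length (Localization.AtPrime q.asIdeal)
    (Localization.AtPrime q.asIdeal ⧸
      (p.asIdeal ⊔ Ideal.span {x}).map (algebraMap A (Localization.AtPrime q.asIdeal)))

/-- If `A_q / (p, x) A_q` is nonzero and of finite length, then `q` is minimal over `(p, x)`. -/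
theorem mem_minimalPrimes_of_localLength (p : PrimeSpectrum A) (x : A)
    (q : PrimeSpectrum A) (h : (localLength p x q).toNat ≠ 0) :
    q.asIdeal ∈ (p.asIdeal ⊔ Ideal.span {x}).minimalPrimes := by
  unfold localLength at h
  generalize hI : p.asIdeal ⊔ Ideal.span {x} = I at h ⊢
  set B := Localization.AtPrime q.asIdeal
  have h0 : Module.length B (B ⧸ I.map (algebraMap A B)) ≠ 0 := by
    intro h'; rw [h'] at h; simp at h
  have h1 : Module.length B (B ⧸ I.map (algebraMap A B)) ≠ ⊤ := by
    intro h'; rw [h'] at h; simp at h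
  have hart : IsArtinian B (B ⧸ I.map (algebraMap A B)) :=
    (isFiniteLength_iff_isNoetherian_isArtinian.mp (Module.length_ne_top_iff.mp h1)).2
  have hartR : IsArtinianRing (B ⧸ I.map (algebraMap A B)) := isArtinian_of_tower B hart
  have hne : I.map (algebraMap A B) ≠ ⊤ := by
    intro h'
    apply h0
    rw [Module.length_eq_zero_iff]
    exact Ideal.Quotient.subsingleton_iff.mpr h'
  have hcm : (IsLocalRing.maximalIdeal B).comap (algebraMap A B) = q.asIdeal :=
    Localization.AtPrime.under_maximalIdeal
  have hle : I ≤ q.asIdeal := by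
    have h2 := IsLocalRing.le_maximalIdeal hne
    have h3 := Ideal.map_le_iff_le_comap.mp h2
    rwa [hcm] at h3
  refine ⟨⟨q.2, hle⟩, ?_⟩
  rintro J ⟨hJp, hIJ⟩ hJq
  have hdisj : Disjoint (q.asIdeal.primeCompl : Set A) (J : Set A) := by
    rw [Set.disjoint_left]
    exact fun a ha haJ => ha (hJq haJ)
  have hJB : (J.map (algebraMap A B)).IsPrime :=
    IsLocalization.isPrime_of_isPrime_disjoint q.asIdeal.primeCompl B J hJp hdisj
  have hmax : (J.map (algebraMap A B)).IsMaximal := by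
    have hIJB : I.map (algebraMap A B) ≤ J.map (algebraMap A B) := Ideal.map_mono hIJ
    have hp : ((J.map (algebraMap A B)).map
        (Ideal.Quotient.mk (I.map (algebraMap A B)))).IsPrime := by
      apply Ideal.map_isPrime_of_surjective Ideal.Quotient.mk_surjective
      rwa [Ideal.mk_ker]
    have hm := IsArtinianRing.isMaximal_of_isPrime ((J.map (algebraMap A B)).map
        (Ideal.Quotient.mk (I.map (algebraMap A B))))
    have := Ideal.comap_isMaximal_of_surjective
      (Ideal.Quotient.mk (I.map (algebraMap A B))) Ideal.Quotient.mk_surjective (K :=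
        (J.map (algebraMap A B)).map (Ideal.Quotient.mk (I.map (algebraMap A B))))
    rwa [Ideal.comap_map_of_surjective _ Ideal.Quotient.mk_surjective, ← RingHom.ker_eq_comap_bot,
      Ideal.mk_ker, sup_of_le_left hIJB] at this
  have hJeq := IsLocalRing.eq_maximalIdeal hmax
  have hc : (J.map (algebraMap A B)).comap (algebraMap A B) = J :=
    IsLocalization.under_map_of_isPrime_disjoint q.asIdeal.primeCompl B hJp hdisj
  rw [hJeq, hcm] at hc
  exact hc.le

variable (D : DimensionTheory A)

open Classical in
/-- The coefficient of `[A / q]` in `div(p, x)`: it is the length of `A_q / (p, x) A_q` when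
`dim A/q = dim A/p - 1`, and `0` for all other primes `q`. -/
noncomputable def divCoeff (p : PrimeSpectrum A) (x : A) (q : PrimeSpectrum A) : ℤ :=
  if D.dim p = D.dim q + 1 then ((localLength p x q).toNat : ℤ) else 0

variable [IsNoetherianRing A]

theorem finite_support_divCoeff (p : PrimeSpectrum A) (x : A) :
    (Function.support (divCoeff D p x)).Finite := by
  have hfin := (p.asIdeal ⊔ Ideal.span {x}).finite_minimalPrimes_of_isNoetherianRing
  refine (hfin.preimage (f := PrimeSpectrum.asIdeal)
    (fun a _ b _ h => PrimeSpectrum.ext h)).subset ?_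
  intro q hq
  apply mem_minimalPrimes_of_localLength
  intro h0
  apply hq
  simp [divCoeff, h0]

/-- The cycle `div(p, x) = ∑ ℓ(A_q / (p, x) A_q) [A / q]`, summed over the primes `q` with
`dim A/q = dim A/p - 1`. It is used only for `x ∉ p`. -/
noncomputable def div (p : PrimeSpectrum A) (x : A) : Cycle A :=
  Finsupp.ofSupportFinite (divCoeff D p x) (finite_support_divCoeff D p x)

/-- The cycle `div(p, x / y) = div(p, x) - div(p, y)` of the rational function `x / y` on `A / p`,
for `x` and `y` outside `p`. -/
noncomputable def divFrac (p : PrimeSpectrum A) (x y : p.asIdeal.primeCompl) : Cycle A :=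
  div D p (x : A) - div D p (y : A)

open Classical in
/-- Intersection with the principal divisor `(u)`: the additive map on cycles that sends `[A / p]`
to `0` if `u ∈ p`, and to `div(p, u)` if `u ∉ p`. -/
noncomputable def cap (u : A) : Cycle A →ₗ[ℤ] Cycle A :=
  Finsupp.linearCombination ℤ fun p : PrimeSpectrum A =>
    if u ∈ p.asIdeal then 0 else div D p u

end Noetherian

section Normal

variable {A : Type*} [CommRing A] [IsDomain A]

variable (A) in
/-- The cycle `[A]` of a domain `A`, the basis element of the zero ideal. -/
noncomputable def fundamentalCycle : Cycle A := Finsupp.single ⊥ 1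

variable [IsNoetherianRing A] [IsIntegrallyClosed A]

/-- The localization of a Noetherian normal domain at a height one prime is a discrete valuation
ring. -/
theorem isDiscreteValuationRing_localization (p : PrimeSpectrum A) (hp : p.asIdeal.height = 1) :
    IsDiscreteValuationRing (Localization.AtPrime p.asIdeal) := by
  have hdim : ringKrullDim (Localization.AtPrime p.asIdeal) = 1 := by
    rw [IsLocalization.AtPrime.ringKrullDim_eq_height p.asIdeal, hp]; rfl
  have hnf : ¬ IsField (Localization.AtPrime p.asIdeal) := by
    intro hf
    rw [ringKrullDim_eq_zero_of_isField hf] at hdim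
    exact zero_ne_one hdim
  have : IsNoetherianRing (Localization.AtPrime p.asIdeal) :=
    IsLocalization.isNoetherianRing p.asIdeal.primeCompl _ inferInstance
  have : IsIntegrallyClosed (Localization.AtPrime p.asIdeal) :=
    isIntegrallyClosed_of_isLocalization _ p.asIdeal.primeCompl
      p.asIdeal.primeCompl_le_nonZeroDivisors
  have : Ring.KrullDimLE 1 (Localization.AtPrime p.asIdeal) :=
    Ring.krullDimLE_iff.mpr hdim.le
  have : Ring.DimensionLEOne (Localization.AtPrime p.asIdeal) :=
    ⟨fun {I} hI hIp => Ideal.isMaximal_of_isPrime_of_ne_bot I hI⟩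
  have : IsDedekindRing (Localization.AtPrime p.asIdeal) := {}
  have : IsDedekindDomain (Localization.AtPrime p.asIdeal) := {}
  exact ((IsDiscreteValuationRing.TFAE (Localization.AtPrime p.asIdeal) hnf).out 0 2).mpr this

/-- The order `ν_p(x)` of a nonzero element `x` of a Noetherian normal domain `A` at a height one
prime `p`, that is, the value of `x` under the normalized valuation of the discrete valuation
ring `A_p`. -/
noncomputable def orderAt (p : PrimeSpectrum A) (hp : p.asIdeal.height = 1) (x : A) : ℕ :=
  haveI := isDiscreteValuationRing_localization p hp
  (IsDiscreteValuationRing.addVal (Localization.AtPrime p.asIdeal)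
    (algebraMap A (Localization.AtPrime p.asIdeal) x)).toNat

end Normal

end CycleIntersection

namespace CycleIntersection

/-! ### Lengths of subquotients of a ring. -/

section RelativeLength

variable {R : Type*} [CommRing R]

/-! Compare coefficients at a prime `Q`. Both sides vanish there unless `D.dim ⊥ = D.dim Q + 2`. In
that case every height-one prime `q ≤ Q` is covered by `Q`, and the claim becomes a reciprocity law
in the normal local ring `A_Q`: the tame symbols `v ^ ord u / u ^ ord v` at the height-one primes `q
≤ Q` containing `u` or `v` have orders along `A_Q / q` that sum to zero. Primes containing just one
of `u`, `v` give the two iterated intersections; primes containing both give the right-hand side.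
The usual sign in the symbol is a unit, so it does not affect orders.

For reciprocity (`ValuedPrimes.sum_resOrd_eq`), let `I_E` be the ideal of elements of order at least
`E i` at each `q i`, and write `e_i` for the unit vectors. The quotient `I_E / I_(E + e_i)` has rank
one over `R / q i`; `stepLength` is its colength over a standard element of order `E i`. Added up
along a lattice path, these numbers depend only on the endpoints (`stepLength_square`,
`pathLength_perm`). By normality, multiplication by `u` maps `I_E` onto `I_(E + n)`, where `n` is
the order vector of `u`. Translating a path by `n` therefore changes its length only by the orders
of the leading coefficients of `u` (`stepLength_add`). Let `m` be the order vector of `v`. Comparing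
the path from `0` to `n + m` through `n` with the one through `m` gives the law.

Normality enters through `exists_height_eq_one_of_not_dvd`: divisibility can be tested at height-one
primes. -/

theorem mem_submoduleOf_iff {N M : Ideal R} {x : M} : x ∈ N.submoduleOf M ↔ (x : R) ∈ N := Iff.rfl

/-- The length of `M / N` for ideals `N ≤ M`. -/
noncomputable def relLength (N M : Ideal R) : ℕ∞ :=
  Module.length R (M ⧸ N.submoduleOf M)

/-- The two hypotheses say that the map `M → M' / N'` induced by `f` is onto and has kernel `N`. -/
theorem relLength_eq_of_map (f : R →ₗ[R] R) {N M N' M' : Ideal R}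
    (hM : Submodule.map f M ⊔ N' = M') (hN : M ⊓ Submodule.comap f N' = N) :
    relLength N M = relLength N' M' := by
  have hf : ∀ x ∈ M, f x ∈ M' := fun x hx =>
    hM ▸ Submodule.mem_sup_left (Submodule.mem_map_of_mem hx)
  let φ : M →ₗ[R] M' ⧸ N'.submoduleOf M' := (N'.submoduleOf M').mkQ ∘ₗ f.restrict hf
  have hφ : Function.Surjective φ := by
    intro y
    obtain ⟨⟨y, hy⟩, rfl⟩ := Submodule.mkQ_surjective _ y
    obtain ⟨z, hz, w, hw, rfl⟩ := Submodule.mem_sup.mp (hM.symm ▸ hy)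
    obtain ⟨x, hx, rfl⟩ := hz
    refine ⟨⟨x, hx⟩, ?_⟩
    simp only [φ, LinearMap.comp_apply]
    rw [← sub_eq_zero, ← map_sub, Submodule.mkQ_apply, Submodule.Quotient.mk_eq_zero,
      mem_submoduleOf_iff]
    simpa using hw
  have hker : LinearMap.ker φ = N.submoduleOf M := by
    ext ⟨x, hx⟩
    rw [LinearMap.mem_ker]
    simp only [φ, LinearMap.comp_apply]
    rw [Submodule.mkQ_apply, Submodule.Quotient.mk_eq_zero,
      mem_submoduleOf_iff, mem_submoduleOf_iff, ← hN]
    simp [hx]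
  exact ((Submodule.quotEquivOfEq _ _ hker.symm).trans
    (φ.quotKerEquivOfSurjective hφ)).length_eq

theorem relLength_add {N M P : Ideal R} (hNM : N ≤ M) (hMP : M ≤ P) :
    relLength N P = relLength N M + relLength M P := by
  let i : (M ⧸ N.submoduleOf M) →ₗ[R] (P ⧸ N.submoduleOf P) :=
    Submodule.mapQ _ _ (Submodule.inclusion hMP) (fun x hx => hx)
  let p : (P ⧸ N.submoduleOf P) →ₗ[R] (P ⧸ M.submoduleOf P) :=
    Submodule.factor (fun x hx => hNM hx)
  refine Module.length_eq_add_of_exact i p ?_ (Submodule.factor_surjective _) ?_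
  · rw [← LinearMap.ker_eq_bot, LinearMap.ker_eq_bot']
    intro x hx
    obtain ⟨x, rfl⟩ := Submodule.mkQ_surjective _ x
    have hx : (Submodule.Quotient.mk (Submodule.inclusion hMP x) : P ⧸ N.submoduleOf P) = 0 := hx
    rw [Submodule.Quotient.mk_eq_zero] at hx
    rw [Submodule.mkQ_apply, Submodule.Quotient.mk_eq_zero]
    exact hx
  · intro y
    obtain ⟨⟨y, hy⟩, rfl⟩ := Submodule.mkQ_surjective _ y
    rw [Submodule.mkQ_apply]
    constructor
    · intro h
      have h : (Submodule.Quotient.mk ⟨y, hy⟩ : P ⧸ M.submoduleOf P) = 0 := h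
      rw [Submodule.Quotient.mk_eq_zero, mem_submoduleOf_iff] at h
      exact ⟨Submodule.Quotient.mk ⟨y, h⟩, rfl⟩
    · rintro ⟨x, hx⟩
      obtain ⟨⟨x, hxM⟩, rfl⟩ := Submodule.mkQ_surjective _ x
      rw [← hx]
      change (Submodule.Quotient.mk ⟨x, hMP hxM⟩ : P ⧸ M.submoduleOf P) = 0
      rw [Submodule.Quotient.mk_eq_zero, mem_submoduleOf_iff]
      exact hxM

theorem relLength_top (I : Ideal R) : relLength I ⊤ = Module.length R (R ⧸ I) := by
  refine LinearEquiv.length_eq (Submodule.Quotient.equiv _ _ Submodule.topEquiv ?_)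
  ext x
  rw [Submodule.mem_map_equiv]
  rfl

/-- If `{r | r * g ∈ N} = q`, then replacing `g` by `c * g` changes the colength of `N + (g)` by the
length of `R / (q, c)`. -/
theorem relLength_sup_span_mul {N M q : Ideal R} (hNM : N ≤ M) {g : R} (hg : g ∈ M)
    (hq : ∀ r, r * g ∈ N ↔ r ∈ q) (c : R) :
    relLength (N ⊔ Ideal.span {c * g}) M =
      relLength (q ⊔ Ideal.span {c}) ⊤ + relLength (N ⊔ Ideal.span {g}) M := by
  have hle : N ⊔ Ideal.span {c * g} ≤ N ⊔ Ideal.span {g} :=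
    sup_le_sup_left (Ideal.span_singleton_le_span_singleton.mpr (Dvd.intro_left c rfl)) _
  rw [relLength_add hle (sup_le hNM ((Ideal.span_singleton_le_iff_mem _).mpr hg))]
  -- Multiplication by `g` identifies `R / (q, c)` with `(N + (g)) / (N + (c * g))`.
  congr 1
  symm
  refine relLength_eq_of_map (LinearMap.toSpanSingleton R R g) ?_ ?_
  · apply le_antisymm
    · refine sup_le ?_ hle
      rintro _ ⟨r, -, rfl⟩
      exact Submodule.mem_sup_right (Ideal.mul_mem_left _ r (Ideal.mem_span_singleton_self g))
    · refine sup_le (le_sup_of_le_right le_sup_left) ?_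
      rw [Ideal.span_singleton_le_iff_mem]
      exact Submodule.mem_sup_left ⟨1, trivial, by simp⟩
  · rw [top_inf_eq]
    ext r
    simp only [Submodule.mem_comap, LinearMap.toSpanSingleton_apply, smul_eq_mul]
    rw [sup_comm N, sup_comm q, Ideal.mem_span_singleton_sup, Ideal.mem_span_singleton_sup]
    constructor
    · rintro ⟨s, n, hn, h⟩
      exact ⟨s, r - s * c, (hq _).mp (by rwa [sub_mul, ← h, mul_assoc, add_sub_cancel_left]),
        by ring⟩
    · rintro ⟨s, n, hn, rfl⟩
      exact ⟨s, n * g, (hq n).mpr hn, by ring⟩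

/-- Modulo the annihilator the ring is Noetherian of dimension zero, hence Artinian. -/
theorem isFiniteLength_of_forall_isMaximal [IsNoetherianRing R] {M : Type*} [AddCommGroup M]
    [Module R M] [Module.Finite R M]
    (h : ∀ P : Ideal R, P.IsPrime → Module.annihilator R M ≤ P → P.IsMaximal) :
    IsFiniteLength R M := by
  rw [isFiniteLength_iff_isNoetherian_isArtinian]
  refine ⟨inferInstance, ?_⟩
  let J := Module.annihilator R M
  have : Ring.KrullDimLE 0 (R ⧸ J) := by
    refine Ideal.krullDimLE_zero_quotient_iff_forall_minimalPrimes_isMaximal.mpr ?_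
    exact fun P hP => h P hP.1.1 hP.1.2
  have : IsArtinianRing (R ⧸ J) := IsNoetherianRing.isArtinianRing_of_krullDimLE_zero
  let _ : Module (R ⧸ J) M := Module.quotientAnnihilator
  have : Module.Finite (R ⧸ J) M := Module.Finite.of_restrictScalars_finite R _ _
  have : IsArtinian (R ⧸ J) M := inferInstance
  exact isArtinian_of_surjective_algebraMap (Ideal.Quotient.mk_surjective (I := J))

/-- Finiteness of the relative length when `M / N` is torsion over `R / q`, and `q` is a prime all
of whose proper prime overideals are maximal. -/
theorem relLength_ne_top [IsNoetherianRing R] {N M q : Ideal R} [q.IsPrime]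
    (hq : ∀ P : Ideal R, P.IsPrime → q < P → P.IsMaximal) (hmul : ∀ r ∈ q, ∀ x ∈ M, r * x ∈ N)
    (htors : ∀ x ∈ M, ∃ d ∉ q, d * x ∈ N) : relLength N M ≠ ⊤ := by
  rw [relLength, Module.length_ne_top_iff]
  apply isFiniteLength_of_forall_isMaximal
  intro P hP hann
  refine hq P hP (lt_of_le_of_ne (le_trans ?_ hann) ?_)
  · intro r hr
    rw [Module.mem_annihilator]
    intro x
    obtain ⟨x, rfl⟩ := Submodule.mkQ_surjective _ x
    rw [← map_smul, Submodule.mkQ_apply, Submodule.Quotient.mk_eq_zero]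
    exact hmul r hr x x.2
  -- The torsion hypothesis makes the localization of `M / N` at `q` vanish, so `q` itself is not in
  -- the support.
  · rintro rfl
    have hmem : (⟨q, hP⟩ : PrimeSpectrum R) ∈ Module.support R (M ⧸ N.submoduleOf M) :=
      Module.mem_support_iff_of_finite.mpr hann
    revert hmem
    rw [imp_false, Module.notMem_support_iff']
    intro x
    obtain ⟨x, rfl⟩ := Submodule.mkQ_surjective _ x
    obtain ⟨d, hd, hdx⟩ := htors x x.2
    refine ⟨d, hd, ?_⟩
    rw [← map_smul, Submodule.mkQ_apply, Submodule.Quotient.mk_eq_zero]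
    exact hdx

end RelativeLength

/-! ### Families of valued primes and the ideals `I_E`. -/

/-- A family of primes `q i` of a domain, with discrete valuations `ord i` having the localizations
at the `q i` as valuation rings, such that the rings `R / q i` have dimension at most one. -/
structure ValuedPrimes (R : Type*) [CommRing R] (ι : Type*) where
  prime : ι → Ideal R
  isPrime : ∀ i, (prime i).IsPrime
  isMaximal_of_lt : ∀ i (P : Ideal R), P.IsPrime → prime i < P → P.IsMaximal
  not_le : ∀ i j, i ≠ j → ¬ prime j ≤ prime i
  ord : ι → AddValuation R ℕ∞
  ord_pos_iff : ∀ i x, 0 < ord i x ↔ x ∈ prime i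
  unif : ι → R
  ord_unif : ∀ i, ord i (unif i) = 1
  exists_mul_eq : ∀ i x y, ord i x = ord i y →
    ∃ c d, c ∉ prime i ∧ d ∉ prime i ∧ c * x = d * y

theorem exists_list_count {ι : Type*} [Fintype ι] [DecidableEq ι] (n : ι → ℕ) : ∃ l : List ι, (fun i => l.count i) = n :=
  ⟨(Finsupp.toMultiset (Finsupp.equivFunOnFinite.symm n)).toList, by
    ext i
    rw [← Multiset.coe_count, Multiset.coe_toList, Finsupp.count_toMultiset]
    rfl⟩

theorem sum_map_eq_sum_count {ι : Type*} [Fintype ι] [DecidableEq ι] (l : List ι) (f : ι → ℕ) :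
    (l.map f).sum = ∑ i, l.count i * f i := by
  rw [Finset.sum_list_map_count]
  refine Finset.sum_subset (Finset.subset_univ _) fun i _ hi => ?_
  rw [List.count_eq_zero_of_not_mem (fun h => hi (List.mem_toFinset.mpr h)), zero_smul]

namespace ValuedPrimes

variable {R : Type*} [CommRing R] {ι : Type*} (V : ValuedPrimes R ι)

instance (i : ι) : (V.prime i).IsPrime := V.isPrime i

theorem ord_eq_zero_iff {i : ι} {x : R} : V.ord i x = 0 ↔ x ∉ V.prime i := by
  rw [← V.ord_pos_iff, pos_iff_ne_zero, not_not]

/-- The ideal of the elements `x` with `ord i x ≥ E i` for all `i`. -/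
def ideal (E : ι → ℕ) : Ideal R where
  carrier := {x | ∀ i, (E i : ℕ∞) ≤ V.ord i x}
  zero_mem' i := by simp
  add_mem' hx hy i := (le_min (hx i) (hy i)).trans ((V.ord i).map_add _ _)
  smul_mem' c x hx i := by
    rw [smul_eq_mul, (V.ord i).map_mul]
    exact (hx i).trans le_add_self

theorem mem_ideal {E : ι → ℕ} {x : R} : x ∈ V.ideal E ↔ ∀ i, (E i : ℕ∞) ≤ V.ord i x := Iff.rfl

theorem ideal_mono {E F : ι → ℕ} (h : E ≤ F) : V.ideal F ≤ V.ideal E :=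
  fun _ hx i => (Nat.cast_le.mpr (h i)).trans (hx i)

/-- The hypothesis `hu` says that the divisor of `u` is supported on the family; it makes `u` divide
every element of the target ideal. -/
theorem map_mul_ideal {u : R} (hu : ∀ y, (∀ i, V.ord i u ≤ V.ord i y) → u ∣ y) {n : ι → ℕ}
    (hn : ∀ i, V.ord i u = n i) (E : ι → ℕ) :
    Submodule.map (LinearMap.toSpanSingleton R R u) (V.ideal E) = V.ideal (E + n) := by
  have key : ∀ x, x * u ∈ V.ideal (E + n) ↔ x ∈ V.ideal E := fun x => by
    refine forall_congr' fun i => ?_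
    rw [(V.ord i).map_mul, hn i, Pi.add_apply, Nat.cast_add]
    exact ENat.add_le_add_iff_right (ENat.natCast_ne_top _)
  ext y
  constructor
  · rintro ⟨x, hx, rfl⟩
    exact (key x).mpr hx
  · intro hy
    obtain ⟨x, rfl⟩ := hu y fun i => by
      rw [hn i]
      exact (Nat.cast_le.mpr (Nat.le_add_left _ _)).trans (hy i)
    rw [mul_comm] at hy ⊢
    exact ⟨x, (key x).mp hy, rfl⟩

/-- The order of vanishing of `c` along `R / q i`. -/
noncomputable def resOrd (i : ι) (c : R) : ℕ :=
  (relLength (V.prime i ⊔ Ideal.span {c}) ⊤).toNat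

theorem resOrd_one (i : ι) : V.resOrd i 1 = 0 := by
  have h : relLength (⊤ : Ideal R) ⊤ = 0 := by
    rw [relLength_top, Module.length_eq_zero_iff]
    infer_instance
  rw [resOrd, Ideal.span_singleton_one, sup_top_eq, h, ENat.toNat_zero]

theorem pow_notMem (i : ι) {c : R} (hc : c ∉ V.prime i) (k : ℕ) : c ^ k ∉ V.prime i :=
  fun h => hc ((V.isPrime i).mem_of_pow_mem k h)

theorem mul_notMem (i : ι) {c d : R} (hc : c ∉ V.prime i) (hd : d ∉ V.prime i) :
    c * d ∉ V.prime i :=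
  fun h => ((V.isPrime i).mem_or_mem h).elim hc hd

/-! ### Standard elements, step lengths and path lengths. -/

section Separator

variable [Fintype ι] [DecidableEq ι]

theorem exists_separator (i : ι) : ∃ s ∉ V.prime i, ∀ j, j ≠ i → s ∈ V.prime j := by
  have h : ¬ (Finset.univ.erase i).inf V.prime ≤ V.prime i := by
    rw [(V.isPrime i).inf_le']
    rintro ⟨j, hj, hle⟩
    exact V.not_le i j (Finset.ne_of_mem_erase hj).symm hle
  obtain ⟨s, hs, hsi⟩ := SetLike.not_le_iff_exists.mp h
  refine ⟨s, hsi, fun j hj => ?_⟩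
  exact (Submodule.mem_finsetInf.mp hs) j (Finset.mem_erase.mpr ⟨hj, Finset.mem_univ j⟩)

/-- An element outside `q i` that lies in all other primes of the family. -/
noncomputable def separator (i : ι) : R := (V.exists_separator i).choose

theorem separator_notMem (i : ι) : V.separator i ∉ V.prime i := (V.exists_separator i).choose_spec.1

theorem separator_mem {i j : ι} (h : j ≠ i) : V.separator i ∈ V.prime j :=
  (V.exists_separator i).choose_spec.2 j h

/-- An element with order `k` at `q i` and order at least `K` at the other primes. -/
noncomputable def gen (K : ℕ) (i : ι) (k : ℕ) : R := V.separator i ^ K * V.unif i ^ k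

theorem ord_gen (K : ℕ) (i : ι) (k : ℕ) : V.ord i (V.gen K i k) = k := by
  rw [gen, (V.ord i).map_mul, (V.ord i).map_pow, (V.ord i).map_pow, V.ord_unif,
    V.ord_eq_zero_iff.mpr (V.separator_notMem i)]
  simp

theorem le_ord_gen (K : ℕ) {i j : ι} (h : j ≠ i) (k : ℕ) : (K : ℕ∞) ≤ V.ord j (V.gen K i k) := by
  rw [gen, (V.ord j).map_mul, (V.ord j).map_pow]
  refine le_add_right ?_
  have : 1 ≤ V.ord j (V.separator i) :=
    Order.one_le_iff_pos.mpr ((V.ord_pos_iff j _).mpr (V.separator_mem h))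
  calc (K : ℕ∞) = K • 1 := by simp
    _ ≤ _ := nsmul_le_nsmul_right this K

theorem gen_mem_ideal {K : ℕ} {E : ι → ℕ} {i : ι} (hE : ∀ j, j ≠ i → E j ≤ K) :
    V.gen K i (E i) ∈ V.ideal E := by
  intro j
  by_cases hj : j = i
  · subst hj; rw [ord_gen]
  · exact (Nat.cast_le.mpr (hE j hj)).trans (V.le_ord_gen K hj _)

/-- The length measuring how far the lattice `I_E / I_{E + q i}` over `R / q i` is from being
generated by the standard element of order `E i`. -/
noncomputable def stepLength (K : ℕ) (E : ι → ℕ) (i : ι) : ℕ :=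
  (relLength (V.ideal (E + Pi.single i 1) ⊔ Ideal.span {V.gen K i (E i)}) (V.ideal E)).toNat

/-- The sum of the step lengths along the path that starts at `E` and adds the primes of `l`. -/
noncomputable def pathLength (K : ℕ) (E : ι → ℕ) : List ι → ℕ
  | [] => 0
  | i :: l => V.stepLength K E i + pathLength K (E + Pi.single i 1) l

theorem pathLength_append (K : ℕ) (l l' : List ι) : ∀ E : ι → ℕ,
    V.pathLength K E (l ++ l') =
      V.pathLength K E l + V.pathLength K (E + fun i => l.count i) l' := by
  induction l with
  | nil =>
    intro E
    simp only [List.nil_append, List.count_nil, pathLength, zero_add]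
    rfl
  | cons i l ih =>
    intro E
    have : (E + fun k => (i :: l).count k) = E + Pi.single i 1 + fun k => l.count k := by
      ext k
      simp only [Pi.add_apply, List.count_cons, Pi.single_apply, beq_iff_eq, eq_comm (a := i)]
      ring
    rw [List.cons_append, pathLength, pathLength, ih, this, ← add_assoc]

end Separator

/-- The class of `g` in `I_E / I_(E + e_i)` has annihilator exactly `q i`, as
`relLength_sup_span_mul` requires. -/
theorem mul_mem_ideal_add_single_iff [DecidableEq ι] {E : ι → ℕ} {i : ι} {g : R} (hg : g ∈ V.ideal E)
    (hgi : V.ord i g = E i) (r : R) : r * g ∈ V.ideal (E + Pi.single i 1) ↔ r ∈ V.prime i := by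
  rw [← V.ord_pos_iff, mem_ideal]
  have key : ((E + Pi.single i 1 : ι → ℕ) i : ℕ∞) ≤ V.ord i (r * g) ↔ 0 < V.ord i r := by
    rw [(V.ord i).map_mul, hgi, Pi.add_apply, Pi.single_eq_same, Nat.cast_add, add_comm,
      ENat.add_le_add_iff_right (ENat.natCast_ne_top _), Nat.cast_one, Order.one_le_iff_pos]
  rw [← key]
  refine ⟨fun h => h i, fun h j => ?_⟩
  by_cases hj : j = i
  · subst hj; exact h
  · rw [Pi.add_apply, Pi.single_eq_of_ne hj, add_zero, (V.ord j).map_mul]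
    exact (hg j).trans le_add_self

/-! ### Finiteness, path independence and reciprocity. -/

section Noetherian

variable [IsNoetherianRing R]

theorem relLength_prime_ne_top (i : ι) {c : R} (hc : c ∉ V.prime i) :
    relLength (V.prime i ⊔ Ideal.span {c}) ⊤ ≠ ⊤ := by
  refine relLength_ne_top (V.isMaximal_of_lt i) (fun r hr x _ => ?_) (fun x _ => ⟨c, hc, ?_⟩)
  · exact Submodule.mem_sup_left (Ideal.mul_mem_right _ _ hr)
  · exact Submodule.mem_sup_right (Ideal.mul_mem_right _ _ (Ideal.mem_span_singleton_self c))

theorem coe_resOrd (i : ι) {c : R} (hc : c ∉ V.prime i) :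
    (V.resOrd i c : ℕ∞) = relLength (V.prime i ⊔ Ideal.span {c}) ⊤ :=
  ENat.natCast_toNat (V.relLength_prime_ne_top i hc)

theorem resOrd_mul (i : ι) {c d : R} (hc : c ∉ V.prime i) (hd : d ∉ V.prime i) :
    V.resOrd i (c * d) = V.resOrd i c + V.resOrd i d := by
  have h := relLength_sup_span_mul (M := ⊤) (q := V.prime i) le_top (g := d) trivial
    (fun r => ⟨fun h => ((V.isPrime i).mem_or_mem h).resolve_right hd,
      fun h => Ideal.mul_mem_right _ _ h⟩) c
  rw [← V.coe_resOrd i hc, ← V.coe_resOrd i hd,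
    ← V.coe_resOrd i (fun h => ((V.isPrime i).mem_or_mem h).elim hc hd)] at h
  exact_mod_cast h

theorem resOrd_pow (i : ι) {c : R} (hc : c ∉ V.prime i) (k : ℕ) :
    V.resOrd i (c ^ k) = k * V.resOrd i c := by
  induction k with
  | zero => simp [resOrd_one]
  | succ k ih => rw [pow_succ, V.resOrd_mul i (V.pow_notMem i hc k) hc, ih]; ring

variable [DecidableEq ι]

/-- The quotient `I_E / I_(E + e_i)` is killed by `q i`, and an element of order exactly `E i`
agrees with `g` up to factors outside `q i`; so the cokernel of `g` is torsion over `R / q i`. -/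
theorem relLength_ideal_ne_top {E : ι → ℕ} {i : ι} {g : R}
    (hgi : V.ord i g = E i) :
    relLength (V.ideal (E + Pi.single i 1) ⊔ Ideal.span {g}) (V.ideal E) ≠ ⊤ := by
  have hmul : ∀ r ∈ V.prime i, ∀ x ∈ V.ideal E, r * x ∈ V.ideal (E + Pi.single i 1) := by
    intro r hr x hx j
    rw [(V.ord j).map_mul, Pi.add_apply, Nat.cast_add, add_comm]
    refine add_le_add ?_ (hx j)
    by_cases hj : j = i
    · subst hj
      rw [Pi.single_eq_same, Nat.cast_one, Order.one_le_iff_pos]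
      exact (V.ord_pos_iff j r).mpr hr
    · rw [Pi.single_eq_of_ne hj]; exact zero_le
  refine relLength_ne_top (V.isMaximal_of_lt i)
    (fun r hr x hx => Submodule.mem_sup_left (hmul r hr x hx)) (fun x hx => ?_)
  by_cases h : V.ord i x = E i
  · obtain ⟨c, d, hc, -, hcd⟩ := V.exists_mul_eq i x g (h.trans hgi.symm)
    refine ⟨c, hc, Submodule.mem_sup_right ?_⟩
    rw [hcd]
    exact Ideal.mul_mem_left _ _ (Ideal.mem_span_singleton_self g)
  · refine ⟨1, (V.isPrime i).one_notMem, Submodule.mem_sup_left ?_⟩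
    rw [one_mul]
    intro j
    by_cases hj : j = i
    · subst hj
      rw [Pi.add_apply, Pi.single_eq_same, Nat.cast_add, Nat.cast_one]
      exact Order.add_one_le_of_lt (lt_of_le_of_ne (hx j) (Ne.symm h))
    · rw [Pi.add_apply, Pi.single_eq_of_ne hj, add_zero]
      exact hx j

variable [Fintype ι]

theorem coe_stepLength (K : ℕ) (E : ι → ℕ) (i : ι) :
    (V.stepLength K E i : ℕ∞) =
      relLength (V.ideal (E + Pi.single i 1) ⊔ Ideal.span {V.gen K i (E i)}) (V.ideal E) :=
  ENat.natCast_toNat (V.relLength_ideal_ne_top (V.ord_gen K i _))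

/-- Raising the `j`-th exponent keeps the same standard element, and the bound by `K` keeps it
inside the smaller ideal. The correction term is symmetric in `i` and `j`, which is what yields
`stepLength_square`. -/
theorem coe_stepLength_eq_add {K : ℕ} {E : ι → ℕ} {i j : ι} (hij : i ≠ j)
    (hE : ∀ k, E k + 1 ≤ K) :
    (V.stepLength K E i : ℕ∞) = V.stepLength K (E + Pi.single j 1) i +
      relLength (V.ideal (E + Pi.single i 1) ⊔ V.ideal (E + Pi.single j 1)) (V.ideal E) := by
  have hE' : ∀ k, k ≠ i → (E + Pi.single j 1 : ι → ℕ) k ≤ K := fun k _ => by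
    refine le_trans ?_ (hE k)
    rw [Pi.add_apply, Pi.single_apply]
    split_ifs <;> omega
  have hEi : (E + Pi.single j 1 : ι → ℕ) i = E i := by
    rw [Pi.add_apply, Pi.single_eq_of_ne hij, add_zero]
  have hg : V.gen K i (E i) ∈ V.ideal (E + Pi.single j 1) := hEi ▸ V.gen_mem_ideal hE'
  have hle : ∀ k, V.ideal (E + Pi.single k 1) ≤ V.ideal E := fun k => V.ideal_mono le_self_add
  rw [V.coe_stepLength, V.coe_stepLength, hEi,
    relLength_add (M := V.ideal (E + Pi.single i 1) ⊔ V.ideal (E + Pi.single j 1))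
      (sup_le_sup_left ((Ideal.span_singleton_le_iff_mem _).mpr hg) _) (sup_le (hle i) (hle j))]
  congr 1
  symm
  refine relLength_eq_of_map LinearMap.id ?_ ?_
  · rw [Submodule.map_id, sup_comm, sup_assoc, sup_eq_right.mpr
      ((Ideal.span_singleton_le_iff_mem _).mpr hg)]
  -- By the modular law, intersecting `I_(E + e_i) + (g)` with `I_(E + e_j)` gives `I_(E + e_i +
  -- e_j) + (g)`.
  · rw [Submodule.comap_id, inf_comm, sup_comm, sup_inf_assoc_of_le _
      ((Ideal.span_singleton_le_iff_mem _).mpr hg), sup_comm]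
    congr 1
    ext x
    rw [Submodule.mem_inf, mem_ideal, mem_ideal, mem_ideal, ← forall_and]
    refine forall_congr' fun k => ?_
    by_cases hki : k = i
    · subst hki
      simp only [Pi.add_apply, Pi.single_eq_same, Pi.single_eq_of_ne hij, add_zero,
        and_iff_left_iff_imp]
      exact fun h => (Nat.cast_le.mpr (Nat.le_succ _)).trans h
    · simp only [Pi.add_apply, Pi.single_eq_of_ne hki, add_zero, and_iff_right_iff_imp]
      exact fun h => (Nat.cast_le.mpr (Nat.le_add_right _ _)).trans h

theorem stepLength_square {K : ℕ} {E : ι → ℕ} {i j : ι} (hE : ∀ k, E k + 1 ≤ K) :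
    V.stepLength K E i + V.stepLength K (E + Pi.single i 1) j =
      V.stepLength K E j + V.stepLength K (E + Pi.single j 1) i := by
  by_cases hij : i = j
  · rw [hij]
  · have h₁ := V.coe_stepLength_eq_add hij hE
    have h₂ := V.coe_stepLength_eq_add (Ne.symm hij) hE
    rw [sup_comm] at h₂
    generalize relLength (V.ideal (E + Pi.single i 1) ⊔ V.ideal (E + Pi.single j 1))
      (V.ideal E) = l at h₁ h₂
    cases l with
    | top => simp at h₁
    | coe l =>
      norm_cast at h₁ h₂
      omega

/-- Adjacent transpositions suffice, and each is one square. The bound leaves room for the exponents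
to grow along the whole path. -/
theorem pathLength_perm {K : ℕ} {l l' : List ι} (h : l.Perm l') :
    ∀ {E : ι → ℕ}, (∀ k, E k + l.length ≤ K) → V.pathLength K E l = V.pathLength K E l' := by
  have hsingle : ∀ (E : ι → ℕ) (i k : ι), (E + Pi.single i 1 : ι → ℕ) k ≤ E k + 1 := by
    intro E i k
    rw [Pi.add_apply, Pi.single_apply]
    split_ifs <;> omega
  induction h with
  | nil => intro E _; rfl
  | cons i h ih =>
    intro E hE
    rw [pathLength, pathLength, ih]
    intro k
    have := hE k
    have := hsingle E i k
    rw [List.length_cons] at *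
    omega
  | swap i j l =>
    intro E hE
    rw [pathLength, pathLength, pathLength, pathLength, ← add_assoc, ← add_assoc, add_right_comm E,
      V.stepLength_square]
    intro k
    have := hE k
    rw [List.length_cons] at this
    omega
  | trans h₁ _ ih₁ ih₂ =>
    intro E hE
    rw [ih₁ hE, ih₂ (by rwa [← h₁.length_eq])]

variable [IsDomain R]

/-- Multiplication by `u` carries the step at `E` to the step at `E + n`, but sends the standard
element to `g * u` instead of the new standard element. The two differ by the leading coefficient `c
/ d` of `u`. -/
theorem stepLength_add {u : R} (hu : ∀ y, (∀ i, V.ord i u ≤ V.ord i y) → u ∣ y) {n : ι → ℕ}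
    (hn : ∀ i, V.ord i u = n i) {K : ℕ} {E : ι → ℕ} (hE : ∀ j, (E + n) j ≤ K) {i : ι} {c d : R}
    (hc : c ∉ V.prime i) (hd : d ∉ V.prime i) (hcd : d * u = c * V.unif i ^ n i) :
    V.stepLength K (E + n) i + V.resOrd i c = V.stepLength K E i + V.resOrd i d := by
  have hE' : ∀ j, j ≠ i → E j ≤ K := fun j _ => (Nat.le_add_right _ _).trans (hE j)
  have hg := V.gen_mem_ideal (i := i) (fun j _ => hE j)
  have hug : V.gen K i (E i) * u ∈ V.ideal (E + n) := by
    rw [← V.map_mul_ideal hu hn E]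
    exact ⟨_, V.gen_mem_ideal hE', rfl⟩
  have hugi : V.ord i (V.gen K i (E i) * u) = (E + n) i := by
    rw [(V.ord i).map_mul, V.ord_gen, hn i]; simp
  have h₁ := relLength_sup_span_mul (V.ideal_mono le_self_add) hg
    (V.mul_mem_ideal_add_single_iff hg (V.ord_gen K i _)) c
  have h₂ := relLength_sup_span_mul (V.ideal_mono le_self_add) hug
    (V.mul_mem_ideal_add_single_iff hug hugi) d
  -- The separator has the same exponent `K` in both standard elements, so they differ exactly by
  -- `V.unif i ^ n i`.
  have heq : c * V.gen K i ((E + n) i) = d * (V.gen K i (E i) * u) := by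
    rw [mul_left_comm d, hcd, gen, gen, Pi.add_apply, pow_add]; ring
  have h₃ : relLength (V.ideal (E + n + Pi.single i 1) ⊔ Ideal.span {V.gen K i (E i) * u})
      (V.ideal (E + n)) = V.stepLength K E i := by
    rw [V.coe_stepLength]
    have hinj : Function.Injective (LinearMap.toSpanSingleton R R u) := by
      rw [← LinearMap.ker_eq_bot, LinearMap.ker_eq_bot']
      intro x hx
      have hu0 : u ≠ 0 := by
        rintro rfl
        have h := hn i
        rw [(V.ord i).map_zero] at h
        exact ENat.top_ne_natCast _ h
      exact (mul_eq_zero.mp hx).resolve_right hu0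
    have hmap : Submodule.map (LinearMap.toSpanSingleton R R u)
        (V.ideal (E + Pi.single i 1) ⊔ Ideal.span {V.gen K i (E i)}) =
        V.ideal (E + n + Pi.single i 1) ⊔ Ideal.span {V.gen K i (E i) * u} := by
      rw [Submodule.map_sup, V.map_mul_ideal hu hn, add_right_comm, Ideal.span,
        Submodule.map_span, Set.image_singleton]
      rfl
    rw [← hmap, ← V.map_mul_ideal hu hn E]
    have hle := sup_le (V.ideal_mono le_self_add : V.ideal (E + Pi.single i 1) ≤ V.ideal E)
      ((Ideal.span_singleton_le_iff_mem _).mpr (V.gen_mem_ideal hE'))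
    refine (relLength_eq_of_map (LinearMap.toSpanSingleton R R u) ?_ ?_).symm
    · exact sup_eq_left.mpr (Submodule.map_mono hle)
    · rw [Submodule.comap_map_eq_of_injective hinj, inf_eq_right.mpr hle]
  rw [heq, h₂, h₃, ← V.coe_stepLength, ← V.coe_resOrd i hc,
    ← V.coe_resOrd i hd] at h₁
  norm_cast at h₁
  omega

theorem pathLength_add {u : R} (hu : ∀ y, (∀ i, V.ord i u ≤ V.ord i y) → u ∣ y) {n : ι → ℕ}
    (hn : ∀ i, V.ord i u = n i) {K : ℕ} {c d : ι → R}
    (hc : ∀ i, c i ∉ V.prime i) (hd : ∀ i, d i ∉ V.prime i)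
    (hcd : ∀ i, d i * u = c i * V.unif i ^ n i) (l : List ι) :
    ∀ E : ι → ℕ, (∀ j, (E + n) j + l.length ≤ K) →
    V.pathLength K (E + n) l + (l.map fun i => V.resOrd i (c i)).sum =
      V.pathLength K E l + (l.map fun i => V.resOrd i (d i)).sum := by
  induction l with
  | nil => intro E _; simp only [pathLength, List.map_nil]
  | cons i l ih =>
    intro E hE
    have h₁ := V.stepLength_add hu hn (fun j => (Nat.le_add_right _ _).trans (hE j))
      (hc i) (hd i) (hcd i)
    have h₂ := ih (E + Pi.single i 1) fun j => by
      have := hE j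
      rw [List.length_cons] at this
      simp only [Pi.add_apply, Pi.single_apply] at this ⊢
      split_ifs <;> omega
    rw [add_right_comm] at h₂
    rw [pathLength, pathLength, List.map_cons, List.map_cons, List.sum_cons, List.sum_cons]
    omega

/-- Reciprocity for two elements whose divisors are supported on the given primes, in terms of
leading coefficients with respect to the chosen uniformizers. -/
theorem sum_mul_resOrd_eq {u v : R} (hu : ∀ y, (∀ i, V.ord i u ≤ V.ord i y) → u ∣ y)
    (hv : ∀ y, (∀ i, V.ord i v ≤ V.ord i y) → v ∣ y) {n m : ι → ℕ}
    (hn : ∀ i, V.ord i u = n i) (hm : ∀ i, V.ord i v = m i) {c d c' d' : ι → R}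
    (hc : ∀ i, c i ∉ V.prime i) (hd : ∀ i, d i ∉ V.prime i)
    (hcd : ∀ i, d i * u = c i * V.unif i ^ n i)
    (hc' : ∀ i, c' i ∉ V.prime i) (hd' : ∀ i, d' i ∉ V.prime i)
    (hcd' : ∀ i, d' i * v = c' i * V.unif i ^ m i) :
    ∑ i, m i * V.resOrd i (d i) + ∑ i, n i * V.resOrd i (c' i) =
      ∑ i, n i * V.resOrd i (d' i) + ∑ i, m i * V.resOrd i (c i) := by
  obtain ⟨lu, rfl⟩ := exists_list_count n
  obtain ⟨lv, rfl⟩ := exists_list_count m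
  let K := lu.length + lv.length
  -- The two paths from `0` to the sum of the order vectors: the primes of `u` first, or those of
  -- `v` first.
  have h := V.pathLength_perm (K := K) (E := 0) (List.perm_append_comm (l₁ := lu) (l₂ := lv))
    (fun k => by simp [K])
  rw [pathLength_append, pathLength_append] at h
  have h₁ := V.pathLength_add hu hn (K := K) hc hd hcd lv 0 fun j => by
    have := lu.count_le_length (a := j)
    simp only [Pi.add_apply, Pi.zero_apply, K]
    omega
  have h₂ := V.pathLength_add hv hm (K := K) hc' hd' hcd' lu 0 fun j => by
    have := lv.count_le_length (a := j)
    simp only [Pi.add_apply, Pi.zero_apply, K]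
    omega
  rw [sum_map_eq_sum_count, sum_map_eq_sum_count] at h₁ h₂
  beta_reduce at h₁ h₂ ⊢
  omega

/-- Reciprocity for two elements whose divisors are supported on the given primes. -/
theorem sum_resOrd_eq {u v : R} (hu : ∀ y, (∀ i, V.ord i u ≤ V.ord i y) → u ∣ y)
    (hv : ∀ y, (∀ i, V.ord i v ≤ V.ord i y) → v ∣ y) {n m : ι → ℕ}
    (hn : ∀ i, V.ord i u = n i) (hm : ∀ i, V.ord i v = m i) {a b : ι → R}
    (ha : ∀ i, a i ∉ V.prime i) (hb : ∀ i, b i ∉ V.prime i)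
    (hab : ∀ i, a i * u ^ m i = b i * v ^ n i) :
    ∑ i, V.resOrd i (a i) = ∑ i, V.resOrd i (b i) := by
  have hunif : ∀ i (k : ℕ), V.ord i (V.unif i ^ k) = k := fun i k => by
    rw [(V.ord i).map_pow, V.ord_unif]; simp
  have hunif0 : ∀ i (k : ℕ), V.unif i ^ k ≠ 0 := fun i k h => by
    have := hunif i k
    rw [h, (V.ord i).map_zero] at this
    exact ENat.top_ne_natCast _ this
  choose d c hd hc hcd using fun i => V.exists_mul_eq i u _ ((hn i).trans (hunif i _).symm)
  choose d' c' hd' hc' hcd' using fun i => V.exists_mul_eq i v _ ((hm i).trans (hunif i _).symm)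
  have key : ∀ i, V.resOrd i (a i) + m i * V.resOrd i (c i) + n i * V.resOrd i (d' i) =
      V.resOrd i (b i) + n i * V.resOrd i (c' i) + m i * V.resOrd i (d i) := by
    intro i
    -- Substitute `u = (c / d) * π ^ n` and `v = (c' / d') * π ^ m`: both sides of `hab` acquire the
    -- factor `π ^ (n * m)`, so the choice of uniformizer drops out.
    have h : a i * c i ^ m i * d' i ^ n i = b i * c' i ^ n i * d i ^ m i := by
      apply mul_right_cancel₀ (hunif0 i (n i * m i))
      have h₁ : (d i * u) ^ m i = (c i * V.unif i ^ n i) ^ m i := by rw [hcd i]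
      have h₂ : (d' i * v) ^ n i = (c' i * V.unif i ^ m i) ^ n i := by rw [hcd' i]
      rw [mul_pow, mul_pow, ← pow_mul] at h₁ h₂
      rw [mul_comm (m i)] at h₂
      linear_combination (-a i * d' i ^ n i) * h₁ + b i * d i ^ m i * h₂ +
        d i ^ m i * d' i ^ n i * hab i
    have hr := congrArg (V.resOrd i) h
    rwa [V.resOrd_mul i (V.mul_notMem i (ha i) (V.pow_notMem i (hc i) _))
        (V.pow_notMem i (hd' i) _), V.resOrd_mul i (ha i) (V.pow_notMem i (hc i) _),
      V.resOrd_mul i (V.mul_notMem i (hb i) (V.pow_notMem i (hc' i) _)) (V.pow_notMem i (hd i) _),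
      V.resOrd_mul i (hb i) (V.pow_notMem i (hc' i) _), V.resOrd_pow i (hc i),
      V.resOrd_pow i (hc' i), V.resOrd_pow i (hd i), V.resOrd_pow i (hd' i)] at hr
  have hsum := Finset.sum_congr (rfl : Finset.univ = Finset.univ) fun i _ => key i
  simp only [Finset.sum_add_distrib] at hsum
  have := V.sum_mul_resOrd_eq hu hv hn hm hc hd hcd hc' hd' hcd'
  omega

end Noetherian
end ValuedPrimes

/-! ### Normality in codimension one. -/

/-- A noetherian normal domain is determined in codimension one: if `w` does not divide `y`, then
this is already so at some height one prime containing `w`. -/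
theorem exists_height_eq_one_of_not_dvd {B : Type*} [CommRing B] [IsDomain B] [IsNoetherianRing B]
    [IsIntegrallyClosed B] {w y : B} (hw : w ≠ 0) (hwy : ¬ w ∣ y) :
    ∃ P : PrimeSpectrum B, P.asIdeal.height = 1 ∧ w ∈ P.asIdeal ∧
      ∀ d, w ∣ d * y → d ∈ P.asIdeal := by
  obtain ⟨P, hP, hle⟩ := exists_le_isAssociatedPrime_of_isNoetherianRing B
    (Ideal.Quotient.mk (Ideal.span {w}) y)
    (by rwa [Ne, Ideal.Quotient.eq_zero_iff_mem, Ideal.mem_span_singleton])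
  have hcolon : ∀ d z : B, d ∈ (⊥ : Submodule B (B ⧸ Ideal.span {w})).colon
      {Ideal.Quotient.mk (Ideal.span {w}) z} ↔ w ∣ d * z := fun d z => by
    rw [Submodule.mem_colon_singleton, Submodule.mem_bot, ← Ideal.mem_span_singleton,
      ← Ideal.Quotient.eq_zero_iff_mem, map_mul]
    rfl
  obtain ⟨hPp, z, hz⟩ := (isAssociatedPrime_iff).mp hP
  obtain ⟨z, rfl⟩ := Ideal.Quotient.mk_surjective z
  have hPz : ∀ d, d ∈ P ↔ w ∣ d * z := fun d => by rw [hz, hcolon]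
  have hwP : w ∈ P := (hPz w).mpr (dvd_mul_right w z)
  -- Otherwise multiplication by `z / w` maps the finitely generated ideal `P` into itself, so `z /
  -- w` is integral and hence lies in `B`, giving `1 ∈ P`.
  have hex : ∃ a ∈ P, ∃ b ∉ P, a * z = w * b := by
    by_contra! hcon
    let K := FractionRing B
    have hw' : algebraMap B K w ≠ 0 := by simpa using hw
    have hint : IsIntegral B (algebraMap B K z / algebraMap B K w) := by
      refine isIntegral_of_smul_mem_submodule (Submodule.map (Algebra.linearMap B K) P) ?_
        ((IsNoetherian.noetherian P).map _) _ ?_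
      · intro h
        have h0 := Submodule.mem_map_of_mem (f := Algebra.linearMap B K) hwP
        rw [h, Submodule.mem_bot] at h0
        exact hw' h0
      · rintro _ ⟨a, ha, rfl⟩
        obtain ⟨b, hb⟩ := (hPz a).mp ha
        refine ⟨b, by_contra fun hbP => hcon a ha b hbP hb, ?_⟩
        rw [Algebra.linearMap_apply, Algebra.linearMap_apply, smul_eq_mul, div_mul_eq_mul_div,
          eq_div_iff hw', ← map_mul, ← map_mul, mul_comm z, hb, mul_comm]
    obtain ⟨t, ht⟩ := IsIntegrallyClosed.isIntegral_iff.mp hint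
    refine hPp.one_notMem ((hPz 1).mpr ⟨t, ?_⟩)
    rw [eq_div_iff hw', ← map_mul] at ht
    rw [one_mul, mul_comm, (FaithfulSMul.algebraMap_injective B K) ht]
  obtain ⟨a, haP, b, hbP, hab⟩ := hex
  refine ⟨⟨P, hPp⟩, le_antisymm ?_ ?_, hwP, fun d hd => hle ((hcolon d y).mpr hd)⟩
  -- Krull's principal ideal theorem applies because `P` is minimal over `a`: each `d ∈ P` satisfies
  -- `d * b ∈ (a)`, while `b ∉ P`.
  · refine Ideal.height_le_one_of_isPrincipal_of_mem_minimalPrimes (Ideal.span {a}) P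
      ⟨⟨hPp, (Ideal.span_singleton_le_iff_mem _).mpr haP⟩, ?_⟩
    rintro P' ⟨hP', haP'⟩ hle' d hd
    obtain ⟨e, he⟩ := (hPz d).mp hd
    have hdb : d * b = a * e := by
      apply mul_left_cancel₀ hw
      linear_combination (-d) * hab + a * he
    refine (hP'.mem_or_mem (?_ : d * b ∈ P')).resolve_right (fun h => hbP (hle' h))
    rw [hdb]
    exact P'.mul_mem_right _ ((Ideal.span_singleton_le_iff_mem _).mp haP')
  · rw [Order.one_le_iff_pos]
    have hlt : (⊥ : Ideal B) < P := bot_lt_iff_ne_bot.mpr fun h => hw (by rwa [h] at hwP)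
    exact bot_le.trans_lt (Ideal.height_strict_mono_of_isPrime hlt)

/-! ### The height-one primes of the local ring at `Q`. -/

section Localization

variable {A : Type*} [CommRing A]

/-- The canonical map `A_Q → A_p` for primes `p ≤ Q`. -/
noncomputable def localizationMap {p Q : PrimeSpectrum A} (h : p ≤ Q) :
    Localization.AtPrime Q.asIdeal →+* Localization.AtPrime p.asIdeal :=
  IsLocalization.lift (M := Q.asIdeal.primeCompl)
    (g := algebraMap A (Localization.AtPrime p.asIdeal))
    fun y => IsLocalization.map_units _ (⟨y, fun hy => y.2 (h hy)⟩ : p.asIdeal.primeCompl)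

variable {p Q : PrimeSpectrum A} (h : p ≤ Q)

theorem localizationMap_algebraMap (a : A) :
    localizationMap h (algebraMap A _ a) = algebraMap A _ a :=
  IsLocalization.lift_eq _ a

theorem comap_le_of_ne_top {P : Ideal (Localization.AtPrime Q.asIdeal)} (hP : P ≠ ⊤) :
    P.comap (algebraMap A _) ≤ Q.asIdeal :=
  (Ideal.comap_mono (IsLocalRing.le_maximalIdeal hP)).trans_eq
    Localization.AtPrime.under_maximalIdeal

theorem comap_localizationMap_maximalIdeal :
    (IsLocalRing.maximalIdeal (Localization.AtPrime p.asIdeal)).comap (localizationMap h) =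
      p.asIdeal.map (algebraMap A (Localization.AtPrime Q.asIdeal)) := by
  have hc : (localizationMap h).comp (algebraMap A _) = algebraMap A _ :=
    RingHom.ext (localizationMap_algebraMap h)
  rw [← IsLocalization.map_under Q.asIdeal.primeCompl _ (Ideal.comap _ _), Ideal.under,
    Ideal.comap_comap, hc]
  congr 1
  exact Localization.AtPrime.under_maximalIdeal

theorem under_map_localization (h : p ≤ Q) :
    (p.asIdeal.map (algebraMap A (Localization.AtPrime Q.asIdeal))).comap (algebraMap A _) =
      p.asIdeal :=
  Ideal.under_map_of_isLocalizationAtPrime Q.asIdeal h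

theorem algebraMap_mem_map_iff (h : p ≤ Q) {a : A} :
    algebraMap A (Localization.AtPrime Q.asIdeal) a ∈ p.asIdeal.map (algebraMap A _) ↔
      a ∈ p.asIdeal := by
  rw [← Ideal.mem_comap, under_map_localization h]

variable [IsDomain A]

theorem algebraMap_localization_injective (p : PrimeSpectrum A) :
    Function.Injective (algebraMap A (Localization.AtPrime p.asIdeal)) :=
  IsLocalization.injective _ p.asIdeal.primeCompl_le_nonZeroDivisors

theorem localizationMap_injective : Function.Injective (localizationMap h) := by
  rw [injective_iff_map_eq_zero]
  intro x hx
  obtain ⟨⟨a, s⟩, hs⟩ := IsLocalization.surj Q.asIdeal.primeCompl x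
  have h₁ := congrArg (localizationMap h) hs
  rw [map_mul, hx, zero_mul, localizationMap_algebraMap, eq_comm, map_eq_zero_iff _
    (algebraMap_localization_injective p)] at h₁
  have h₂ : x * algebraMap A _ (s : A) = 0 := by rw [hs, h₁, map_zero]
  exact (mul_eq_zero.mp h₂).resolve_right (IsLocalization.map_units _ s).ne_zero

variable [IsNoetherianRing A] [IsIntegrallyClosed A]

/-- The normalized valuation of `A_p`, restricted to `A_Q`. -/
noncomputable def localOrd (h : p ≤ Q) (hp : p.asIdeal.height = 1) :
    AddValuation (Localization.AtPrime Q.asIdeal) ℕ∞ :=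
  haveI := isDiscreteValuationRing_localization p hp
  (IsDiscreteValuationRing.addVal (Localization.AtPrime p.asIdeal)).comap (localizationMap h)

theorem localOrd_apply (hp : p.asIdeal.height = 1) (x : Localization.AtPrime Q.asIdeal) :
    haveI := isDiscreteValuationRing_localization p hp
    localOrd h hp x = IsDiscreteValuationRing.addVal _ (localizationMap h x) := rfl

theorem localOrd_algebraMap (hp : p.asIdeal.height = 1) {a : A} (ha : a ≠ 0) :
    localOrd h hp (algebraMap A _ a) = orderAt p hp a := by
  have := isDiscreteValuationRing_localization p hp
  rw [localOrd_apply, localizationMap_algebraMap, orderAt, ENat.natCast_toNat]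
  rw [Ne, IsDiscreteValuationRing.addVal_eq_top_iff, map_eq_zero_iff _
    (algebraMap_localization_injective p)]
  exact ha

theorem localOrd_pos_iff (hp : p.asIdeal.height = 1) (x : Localization.AtPrime Q.asIdeal) :
    0 < localOrd h hp x ↔ x ∈ p.asIdeal.map (algebraMap A _) := by
  have := isDiscreteValuationRing_localization p hp
  rw [localOrd_apply, pos_iff_ne_zero, Ne, IsDiscreteValuationRing.addVal_eq_zero_iff,
    ← comap_localizationMap_maximalIdeal h, Ideal.mem_comap, IsLocalRing.mem_maximalIdeal,
    mem_nonunits_iff]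

theorem exists_mul_eq_of_localOrd_le (hp : p.asIdeal.height = 1)
    {x y : Localization.AtPrime Q.asIdeal} (hxy : localOrd h hp x ≤ localOrd h hp y) :
    ∃ e f : A, f ∉ p.asIdeal ∧ algebraMap A _ e * x = algebraMap A _ f * y := by
  have := isDiscreteValuationRing_localization p hp
  rw [localOrd_apply, localOrd_apply, IsDiscreteValuationRing.addVal_le_iff_dvd] at hxy
  obtain ⟨w, hw⟩ := hxy
  obtain ⟨⟨e, f⟩, hef⟩ := IsLocalization.surj p.asIdeal.primeCompl w
  refine ⟨e, f, f.2, localizationMap_injective h ?_⟩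
  rw [map_mul, map_mul, localizationMap_algebraMap, localizationMap_algebraMap, hw, ← hef]
  ring

theorem exists_localOrd_eq_one (hp : p.asIdeal.height = 1) : ∃ x, localOrd h hp x = 1 := by
  have := isDiscreteValuationRing_localization p hp
  obtain ⟨ϖ, hϖ⟩ := IsDiscreteValuationRing.exists_irreducible (Localization.AtPrime p.asIdeal)
  obtain ⟨⟨a, s⟩, hs⟩ := IsLocalization.surj p.asIdeal.primeCompl ϖ
  refine ⟨algebraMap A _ a, ?_⟩
  rw [localOrd_apply, localizationMap_algebraMap, ← hs, IsDiscreteValuationRing.addVal_mul,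
    IsDiscreteValuationRing.addVal_uniformizer hϖ,
    IsDiscreteValuationRing.addVal_eq_zero_iff.mpr (IsLocalization.map_units _ s), add_zero]

variable {ι : Type*} {q : ι → PrimeSpectrum A}

/-- The family of height one primes `q i` of the local ring `A_Q`, where `Q` covers all `q i`. -/
noncomputable def localizationValuedPrimes (hinj : Function.Injective q) (hq : ∀ i, q i ⋖ Q)
    (hht : ∀ i, (q i).asIdeal.height = 1) :
    ValuedPrimes (Localization.AtPrime Q.asIdeal) ι where
  prime i := (q i).asIdeal.map (algebraMap A _)
  isPrime i := by
    rw [← comap_localizationMap_maximalIdeal (hq i).le]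
    infer_instance
  isMaximal_of_lt i P hP hlt := by
    have hPQ : P.comap (algebraMap A _) ≤ Q.asIdeal :=
      comap_le_of_ne_top hP.ne_top
    have hle : (q i).asIdeal ≤ P.comap (algebraMap A _) := Ideal.map_le_iff_le_comap.mp hlt.le
    let P' : PrimeSpectrum A := ⟨P.comap (algebraMap A _), inferInstance⟩
    have hmap : P'.asIdeal.map (algebraMap A _) = P :=
      IsLocalization.map_under Q.asIdeal.primeCompl _ P
    have hcases : P' = q i ∨ P' = Q := (hq i).eq_or_eq hle hPQ
    rcases hcases with hc | hc
    · rw [hc] at hmap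
      exact absurd hmap hlt.ne
    · rw [hc, Localization.AtPrime.map_eq_maximalIdeal] at hmap
      rw [← hmap]
      infer_instance
  not_le i j hij hle := by
    have h₁ := Ideal.comap_mono (f := algebraMap A (Localization.AtPrime Q.asIdeal)) hle
    rw [under_map_localization (hq i).le, under_map_localization (hq j).le] at h₁
    have h₁ : q j ≤ q i := h₁
    rcases (hq j).eq_or_eq h₁ (hq i).le with h₂ | h₂
    · exact hij (hinj h₂)
    · exact (hq i).ne h₂
  ord i := localOrd (hq i).le (hht i)
  ord_pos_iff i x := localOrd_pos_iff (hq i).le (hht i) x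
  unif i := (exists_localOrd_eq_one (hq i).le (hht i)).choose
  ord_unif i := (exists_localOrd_eq_one (hq i).le (hht i)).choose_spec
  exists_mul_eq i x y hxy := by
    -- Infinite order forces `x = y = 0`. For finite order, cancelling it shows that `e` and `f`
    -- have equal order, so `e` also lies outside `q i`.
    by_cases hx : localOrd (hq i).le (hht i) x = ⊤
    · have := isDiscreteValuationRing_localization (q i) (hht i)
      have h0 : ∀ z, localOrd (hq i).le (hht i) z = ⊤ → z = 0 := fun z hz => by
        rwa [localOrd_apply, IsDiscreteValuationRing.addVal_eq_top_iff, map_eq_zero_iff _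
          (localizationMap_injective _)] at hz
      have h1 : (1 : Localization.AtPrime Q.asIdeal) ∉ (q i).asIdeal.map (algebraMap A _) := by
        rw [← map_one (algebraMap A _), algebraMap_mem_map_iff (hq i).le]
        exact (q i).2.one_notMem
      exact ⟨1, 1, h1, h1, by rw [h0 x hx, h0 y (hxy ▸ hx)]⟩
    · obtain ⟨e, f, hf, hef⟩ := exists_mul_eq_of_localOrd_le (hq i).le (hht i) hxy.le
      have hf' := (algebraMap_mem_map_iff (hq i).le).not.mpr hf
      refine ⟨_, _, fun he => ?_, hf', hef⟩
      have h₁ := congrArg (localOrd (hq i).le (hht i)) hef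
      rw [AddValuation.map_mul, AddValuation.map_mul, ← hxy] at h₁
      have h₂ := WithTop.add_right_cancel hx h₁
      rw [← localOrd_pos_iff (hq i).le (hht i)] at he hf'
      exact hf' (h₂ ▸ he)

variable (hinj : Function.Injective q) (hq : ∀ i, q i ⋖ Q) (hht : ∀ i, (q i).asIdeal.height = 1)

theorem localizationValuedPrimes_ord (i : ι) {a : A} (ha : a ≠ 0) :
    (localizationValuedPrimes hinj hq hht).ord i (algebraMap A _ a) = orderAt (q i) (hht i) a :=
  localOrd_algebraMap (hq i).le (hht i) ha

theorem algebraMap_notMem_prime (i : ι) {a : A} (ha : a ∉ (q i).asIdeal) :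
    algebraMap A _ a ∉ (localizationValuedPrimes hinj hq hht).prime i :=
  (algebraMap_mem_map_iff (hq i).le).not.mpr ha

theorem localizationValuedPrimes_resOrd (i : ι) (a : A) :
    (localizationValuedPrimes hinj hq hht).resOrd i (algebraMap A _ a) =
      (localLength (q i) a Q).toNat := by
  rw [ValuedPrimes.resOrd, relLength_top, localLength, Ideal.map_sup, Ideal.map_span,
    Set.image_singleton]
  rfl

/-- If divisibility fails, it fails at a height-one prime containing `w`, whose contraction is some
`q i`. The order inequality there provides a denominator `f ∉ q i` with `w ∣ f * y`, a
contradiction. -/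
theorem algebraMap_dvd_of_forall_ord_le {w : A} (hw : w ≠ 0)
    (hall : ∀ p : PrimeSpectrum A, p.asIdeal.height = 1 → p ≤ Q → w ∈ p.asIdeal → ∃ i, q i = p)
    (y : Localization.AtPrime Q.asIdeal)
    (hy : ∀ i, (localizationValuedPrimes hinj hq hht).ord i (algebraMap A _ w) ≤
      (localizationValuedPrimes hinj hq hht).ord i y) : algebraMap A _ w ∣ y := by
  have : IsNoetherianRing (Localization.AtPrime Q.asIdeal) :=
    IsLocalization.isNoetherianRing Q.asIdeal.primeCompl _ inferInstance
  have : IsIntegrallyClosed (Localization.AtPrime Q.asIdeal) :=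
    isIntegrallyClosed_of_isLocalization _ Q.asIdeal.primeCompl
      Q.asIdeal.primeCompl_le_nonZeroDivisors
  by_contra hdvd
  obtain ⟨P, hPht, hwP, hP⟩ := exists_height_eq_one_of_not_dvd
    ((map_ne_zero_iff _ (algebraMap_localization_injective Q)).mpr hw) hdvd
  let P' : PrimeSpectrum A := ⟨P.asIdeal.comap (algebraMap A _), inferInstance⟩
  have hPQ : P' ≤ Q := comap_le_of_ne_top P.2.ne_top
  obtain ⟨i, hi⟩ := hall P' ((IsLocalization.height_under Q.asIdeal.primeCompl P.asIdeal).trans hPht)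
    hPQ hwP
  obtain ⟨e, f, hf, hef⟩ := exists_mul_eq_of_localOrd_le (hq i).le (hht i) (hy i)
  rw [hi] at hf
  exact hf (hP _ (hef ▸ Dvd.intro_left _ rfl))

end Localization

/-! ### Dimension functions and coefficients of iterated intersections. -/

section Dimension

variable {A : Type*} [CommRing A]

theorem divCoeff_ne_zero {D : DimensionTheory A} {p q : PrimeSpectrum A} {x : A}
    (h : divCoeff D p x q ≠ 0) :
    D.dim p = D.dim q + 1 ∧ q.asIdeal ∈ (p.asIdeal ⊔ Ideal.span {x}).minimalPrimes := by
  unfold divCoeff at h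
  split_ifs at h with hdim
  · exact ⟨hdim, mem_minimalPrimes_of_localLength p x q (by exact_mod_cast h)⟩
  · exact absurd rfl h

theorem le_of_divCoeff_ne_zero {D : DimensionTheory A} {p q : PrimeSpectrum A} {x : A}
    (h : divCoeff D p x q ≠ 0) : p ≤ q :=
  le_sup_left.trans (divCoeff_ne_zero h).2.1.2

variable [IsNoetherianRing A]

theorem height_lt_height {p q : PrimeSpectrum A} (h : p < q) :
    p.asIdeal.height < q.asIdeal.height :=
  Ideal.height_strict_mono_of_isPrime h

theorem DimensionTheory.dim_add_one_le (D : DimensionTheory A) {p q : PrimeSpectrum A}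
    (h : p < q) : D.dim q + 1 ≤ D.dim p := by
  -- Induct on the height of `q`, passing to a prime `r` with `p ≤ r ⋖ q`.
  induction hk : q.asIdeal.height using WellFoundedLT.induction generalizing q with
  | ind k ih =>
    have : WellFoundedGT (PrimeSpectrum A) :=
      ⟨InvImage.wf PrimeSpectrum.asIdeal (wellFounded_gt (α := Ideal A))⟩
    obtain ⟨r, hpr, hrq⟩ := exists_le_covBy_of_lt h
    rw [← D.dim_of_covBy r q hrq]
    rcases hpr.eq_or_lt with rfl | hlt
    · exact le_rfl
    · have := ih _ (hk ▸ height_lt_height hrq.lt) hlt rfl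
      omega

theorem DimensionTheory.covBy_of_dim_eq (D : DimensionTheory A) {p q : PrimeSpectrum A}
    (h : p < q) (hdim : D.dim p = D.dim q + 1) : p ⋖ q := by
  refine ⟨h, fun c hpc hcq => ?_⟩
  have := D.dim_add_one_le hpc
  have := D.dim_add_one_le hcq
  omega

variable [IsDomain A]

theorem height_pos_of_mem {q : PrimeSpectrum A} {x : A} (hx : x ≠ 0) (hxq : x ∈ q.asIdeal) :
    0 < q.asIdeal.height := by
  have hlt : ⊥ < q := bot_lt_iff_ne_bot.mpr fun h => hx (by rwa [h] at hxq)
  exact bot_le.trans_lt (height_lt_height hlt)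

theorem bot_covBy_of_height_eq_one {q : PrimeSpectrum A} (hq : q.asIdeal.height = 1) : ⊥ ⋖ q := by
  refine ⟨bot_lt_iff_ne_bot.mpr ?_, fun c hc hcq => ?_⟩
  · rintro rfl
    have h : (⊥ : Ideal A).height = 1 := hq
    rw [Ideal.height_bot] at h
    exact zero_ne_one h
  · have h₁ := height_lt_height hc
    have h₂ := height_lt_height hcq
    rw [hq, Order.lt_one_iff] at h₂
    rw [h₂] at h₁
    exact not_lt_zero h₁

theorem height_eq_one_of_divCoeff_bot_ne_zero {D : DimensionTheory A} {q : PrimeSpectrum A} {x : A}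
    (hx : x ≠ 0) (h : divCoeff D ⊥ x q ≠ 0) : q.asIdeal.height = 1 ∧ x ∈ q.asIdeal := by
  have hmin := (divCoeff_ne_zero h).2
  have hbot : (⊥ : PrimeSpectrum A).asIdeal = ⊥ := rfl
  rw [hbot, bot_sup_eq] at hmin
  have hxq := (Ideal.span_singleton_le_iff_mem _).mp hmin.1.2
  exact ⟨le_antisymm (Ideal.height_le_one_of_isPrincipal_of_mem_minimalPrimes _ _ hmin)
    (Order.one_le_iff_pos.mpr (height_pos_of_mem hx hxq)), hxq⟩

theorem finite_setOf_height_eq_one_mem {x : A} (hx : x ≠ 0) :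
    {q : PrimeSpectrum A | q.asIdeal.height = 1 ∧ x ∈ q.asIdeal}.Finite := by
  have hfin := (Ideal.span {x}).finite_minimalPrimes_of_isNoetherianRing
  refine (hfin.preimage (f := PrimeSpectrum.asIdeal)
    (fun a _ b _ h => PrimeSpectrum.ext h)).subset ?_
  rintro q ⟨hq, hxq⟩
  refine ⟨⟨q.2, (Ideal.span_singleton_le_iff_mem _).mpr hxq⟩, ?_⟩
  rintro P ⟨hP, hxP⟩ hle
  rcases (bot_covBy_of_height_eq_one hq).eq_or_eq (c := ⟨P, hP⟩) bot_le hle with h | h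
  · have h : P = ⊥ := congrArg PrimeSpectrum.asIdeal h
    rw [h, Ideal.span_singleton_le_iff_mem] at hxP
    exact absurd hxP hx
  · exact (congrArg PrimeSpectrum.asIdeal h).ge

-- The freedom in `S` lets both orders of intersection be summed over one common set of primes.
open Classical in
theorem cap_cap_apply (D : DimensionTheory A) {u v : A} (hv : v ≠ 0) {Q : PrimeSpectrum A}
    (S : Finset (PrimeSpectrum A))
    (hS : ∀ q : PrimeSpectrum A, q.asIdeal.height = 1 → v ∈ q.asIdeal → q ≤ Q → q ∈ S) :
    cap D u (cap D v (fundamentalCycle A)) Q =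
      ∑ q ∈ S, divCoeff D ⊥ v q * if u ∈ q.asIdeal then 0 else divCoeff D q u Q := by
  have h₁ : cap D v (fundamentalCycle A) = div D ⊥ v := by
    rw [cap, fundamentalCycle, Finsupp.linearCombination_single, one_smul, if_neg]
    exact hv
  have hdiv : ∀ (p q : PrimeSpectrum A) (x : A), div D p x q = divCoeff D p x q :=
    fun _ _ _ => rfl
  have hterm : ∀ q : PrimeSpectrum A,
      (div D ⊥ v q • (if u ∈ q.asIdeal then 0 else div D q u : Cycle A)) Q =
      divCoeff D ⊥ v q * if u ∈ q.asIdeal then 0 else divCoeff D q u Q := fun q => by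
    rw [Finsupp.smul_apply, smul_eq_mul, hdiv]
    split_ifs
    · rfl
    · rw [hdiv]
  rw [h₁, cap, Finsupp.linearCombination_apply, Finsupp.sum, Finsupp.finsetSum_apply,
    Finset.sum_congr rfl fun q _ => hterm q]
  rw [Finset.sum_subset (Finset.subset_union_left (s₂ := S)),
    ← Finset.sum_subset (Finset.subset_union_right (s₁ := (div D ⊥ v).support) (s₂ := S))]
  · intro q _ hq
    by_contra hne
    split_ifs at hne with huq
    · exact hne (mul_zero _)
    · obtain ⟨h₂, h₃⟩ := height_eq_one_of_divCoeff_bot_ne_zero hv (left_ne_zero_of_mul hne)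
      exact hq (hS q h₂ h₃ (le_of_divCoeff_ne_zero (right_ne_zero_of_mul hne)))
  · intro q _ hq
    rw [Finsupp.notMem_support_iff, hdiv] at hq
    rw [hq, zero_mul]

/-! ### Reciprocity at `Q` and the comparison of coefficients. -/

variable [IsIntegrallyClosed A]

theorem divCoeff_bot (D : DimensionTheory A) {q : PrimeSpectrum A} (hq : q.asIdeal.height = 1)
    (x : A) : divCoeff D ⊥ x q = orderAt q hq x := by
  have := isDiscreteValuationRing_localization q hq
  have hbot : (⊥ : PrimeSpectrum A).asIdeal = ⊥ := rfl
  rw [divCoeff, if_pos (D.dim_of_covBy _ _ (bot_covBy_of_height_eq_one hq)), localLength, orderAt,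
    hbot, bot_sup_eq, Ideal.map_span, Set.image_singleton, ← Ring.ord_eq_addVal, Ring.ord]

theorem orderAt_eq_zero {q : PrimeSpectrum A} (hq : q.asIdeal.height = 1) {x : A}
    (hx : x ∉ q.asIdeal) : orderAt q hq x = 0 := by
  have := isDiscreteValuationRing_localization q hq
  rw [orderAt, IsDiscreteValuationRing.addVal_eq_zero_iff.mpr, ENat.toNat_zero]
  exact IsLocalization.map_units _ (⟨x, hx⟩ : q.asIdeal.primeCompl)

open Classical in
/-- Reciprocity for two nonzero elements at a prime `Q` of height two, summed over the height one
primes `q ≤ Q`: the residues `a q / b q` of the tame symbols have total order zero. -/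
theorem sum_localLength_eq (D : DimensionTheory A) {u v : A} (hu : u ≠ 0) (hv : v ≠ 0)
    {Q : PrimeSpectrum A} (hQ : D.dim ⊥ = D.dim Q + 2) {S : Finset (PrimeSpectrum A)}
    (hS : ∀ q ∈ S, q.asIdeal.height = 1 ∧ q ≤ Q)
    (hS' : ∀ q : PrimeSpectrum A, q.asIdeal.height = 1 → q ≤ Q → u ∈ q.asIdeal ∨ v ∈ q.asIdeal →
      q ∈ S) {a b : S → A} (ha : ∀ q : S, a q ∉ q.1.asIdeal) (hb : ∀ q : S, b q ∉ q.1.asIdeal)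
    (hab : ∀ q : S, a q * u ^ orderAt q.1 (hS q q.2).1 v = b q * v ^ orderAt q.1 (hS q q.2).1 u) :
    ∑ q : S, (localLength q.1 (a q) Q).toNat = ∑ q : S, (localLength q.1 (b q) Q).toNat := by
  have hcov : ∀ q : S, q.1 ⋖ Q := fun q => by
    have h₁ := D.dim_of_covBy _ _ (bot_covBy_of_height_eq_one (hS q q.2).1)
    have hne : q.1 ≠ Q := fun h => by rw [h] at h₁; omega
    exact D.covBy_of_dim_eq (lt_of_le_of_ne (hS q q.2).2 hne) (by omega)
  have : IsNoetherianRing (Localization.AtPrime Q.asIdeal) :=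
    IsLocalization.isNoetherianRing Q.asIdeal.primeCompl _ inferInstance
  have hht : ∀ q : S, q.1.asIdeal.height = 1 := fun q => (hS q q.2).1
  have hinj : Function.Injective (Subtype.val : S → PrimeSpectrum A) := Subtype.val_injective
  have key := (localizationValuedPrimes hinj hcov hht).sum_resOrd_eq
    (algebraMap_dvd_of_forall_ord_le hinj hcov hht hu
      fun p hp hpQ hup => ⟨⟨p, hS' p hp hpQ (Or.inl hup)⟩, rfl⟩)
    (algebraMap_dvd_of_forall_ord_le hinj hcov hht hv
      fun p hp hpQ hvp => ⟨⟨p, hS' p hp hpQ (Or.inr hvp)⟩, rfl⟩)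
    (fun q => localizationValuedPrimes_ord hinj hcov hht q hu)
    (fun q => localizationValuedPrimes_ord hinj hcov hht q hv)
    (a := fun q => algebraMap A _ (a q)) (b := fun q => algebraMap A _ (b q))
    (fun q => algebraMap_notMem_prime hinj hcov hht q (ha q))
    (fun q => algebraMap_notMem_prime hinj hcov hht q (hb q))
    (fun q => by rw [← map_pow, ← map_pow, ← map_mul, ← map_mul, hab q])
  simpa only [localizationValuedPrimes_resOrd] using key

/-- This is additivity of the order of vanishing, applied to the family consisting of `p` alone. -/
theorem localLength_pow {p Q : PrimeSpectrum A} (hpQ : p ⋖ Q) (hp : p.asIdeal.height = 1) {x : A}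
    (hx : x ∉ p.asIdeal) (k : ℕ) :
    (localLength p (x ^ k) Q).toNat = k * (localLength p x Q).toNat := by
  have : IsNoetherianRing (Localization.AtPrime Q.asIdeal) :=
    IsLocalization.isNoetherianRing Q.asIdeal.primeCompl _ inferInstance
  have hinj : Function.Injective (fun _ : Unit => p) := Function.injective_of_subsingleton _
  have h := (localizationValuedPrimes hinj (fun _ => hpQ) (fun _ => hp)).resOrd_pow ()
    (algebraMap_notMem_prime hinj (fun _ => hpQ) (fun _ => hp) () hx) k
  rwa [← map_pow, localizationValuedPrimes_resOrd, localizationValuedPrimes_resOrd] at h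

/-- The commutator of the intersections with two principal divisors on a normal domain. -/
theorem cap_cap_sub_cap_cap (D : DimensionTheory A)
    (u v : A) (hu : u ≠ 0) (hv : v ≠ 0)
    (r : ℕ) (p : Fin r → PrimeSpectrum A) (hinj : Function.Injective p)
    (hp : ∀ i, (p i).asIdeal.height = 1)
    (hmem : ∀ i, u ∈ (p i).asIdeal ∧ v ∈ (p i).asIdeal)
    (hall : ∀ q : PrimeSpectrum A, q.asIdeal.height = 1 → u ∈ q.asIdeal → v ∈ q.asIdeal →
      ∃ i, p i = q)
    (n m : Fin r → ℕ)
    (hn : ∀ i, n i = orderAt (p i) (hp i) u)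
    (hm : ∀ i, m i = orderAt (p i) (hp i) v)
    (a b : ∀ i, (p i).asIdeal.primeCompl)
    (hab : ∀ i, algebraMap A (FractionRing A) (a i : A) / algebraMap A (FractionRing A) (b i : A) =
      algebraMap A (FractionRing A) v ^ n i / algebraMap A (FractionRing A) u ^ m i) :
    cap D u
        (cap D v (fundamentalCycle A)) -
      cap D v
        (cap D u (fundamentalCycle A)) =
      ∑ i, divFrac D (p i) (a i) (b i) := by
  classical
  have hdim : ∀ q : PrimeSpectrum A, q.asIdeal.height = 1 → D.dim ⊥ = D.dim q + 1 :=
    fun q hq => D.dim_of_covBy _ _ (bot_covBy_of_height_eq_one hq)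
  have hab' : ∀ i, (a i : A) * u ^ m i = b i * v ^ n i := fun i => by
    have hinjK := FaithfulSMul.algebraMap_injective A (FractionRing A)
    have hb0 : algebraMap A (FractionRing A) (b i : A) ≠ 0 := by
      rw [map_ne_zero_iff _ hinjK]
      exact fun h => (b i).2 (h ▸ (p i).asIdeal.zero_mem)
    have hu0 : algebraMap A (FractionRing A) u ^ m i ≠ 0 :=
      pow_ne_zero _ ((map_ne_zero_iff _ hinjK).mpr hu)
    apply hinjK
    have h := hab i
    rw [div_eq_div_iff hb0 hu0] at h
    rw [map_mul, map_mul, map_pow, map_pow, h, mul_comm]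
  ext Q
  have hfin : {q : PrimeSpectrum A | q.asIdeal.height = 1 ∧ q ≤ Q ∧
      (u ∈ q.asIdeal ∨ v ∈ q.asIdeal)}.Finite := by
    refine ((finite_setOf_height_eq_one_mem hu).union (finite_setOf_height_eq_one_mem hv)).subset ?_
    rintro q ⟨h₁, -, h₂ | h₂⟩
    · exact Or.inl ⟨h₁, h₂⟩
    · exact Or.inr ⟨h₁, h₂⟩
  obtain ⟨S, hS⟩ : ∃ S : Finset (PrimeSpectrum A), ∀ q, q ∈ S ↔ q.asIdeal.height = 1 ∧ q ≤ Q ∧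
      (u ∈ q.asIdeal ∨ v ∈ q.asIdeal) := ⟨hfin.toFinset, fun q => hfin.mem_toFinset⟩
  rw [Finsupp.sub_apply, Finsupp.finsetSum_apply,
    cap_cap_apply D hv S fun q h₁ h₂ h₃ => (hS q).mpr ⟨h₁, h₃, Or.inr h₂⟩,
    cap_cap_apply D hu S fun q h₁ h₂ h₃ => (hS q).mpr ⟨h₁, h₃, Or.inl h₂⟩]
  have hdivFrac : ∀ i, divFrac D (p i) (a i) (b i) Q =
      divCoeff D (p i) (a i) Q - divCoeff D (p i) (b i) Q := fun i => rfl
  simp only [hdivFrac]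
  by_cases hQ : D.dim ⊥ = D.dim Q + 2
  · have hcoeff : ∀ q ∈ S, ∀ x, divCoeff D q x Q = (localLength q x Q).toNat := fun q hq x => by
      rw [divCoeff, if_pos]
      have := hdim q ((hS q).mp hq).1
      omega
    have hcov : ∀ q ∈ S, q ⋖ Q := fun q hq => by
      have h := hdim q ((hS q).mp hq).1
      have hne : q ≠ Q := fun h' => by rw [h'] at h; omega
      exact D.covBy_of_dim_eq (lt_of_le_of_ne ((hS q).mp hq).2.1 hne) (by omega)
    -- Write the tame symbol at `q` as `d / c` inverted, that is `c / d`: take `a i / b i` if `q`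
    -- contains both elements, `v ^ ord u / 1` if only `u`, and `1 / u ^ ord v` if `u ∉ q`. In each
    -- case its order is minus the local discrepancy between the two sides.
    have hex : ∀ q : S, ∃ c d : A, c ∉ q.1.asIdeal ∧ d ∉ q.1.asIdeal ∧
        c * u ^ orderAt q.1 ((hS q).mp q.2).1 v = d * v ^ orderAt q.1 ((hS q).mp q.2).1 u ∧
        ((divCoeff D ⊥ v q * if u ∈ q.1.asIdeal then 0 else divCoeff D q u Q) -
          (divCoeff D ⊥ u q * if v ∈ q.1.asIdeal then 0 else divCoeff D q v Q)) -
          (∑ i, if p i = q then divCoeff D (p i) (a i) Q - divCoeff D (p i) (b i) Q else 0) =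
        ((localLength q.1 d Q).toNat : ℤ) - ((localLength q.1 c Q).toNat : ℤ) := by
      rintro ⟨q, hq⟩
      have hht := ((hS q).mp hq).1
      have hone : (localLength q 1 Q).toNat = 0 := by
        have := localLength_pow (hcov q hq) hht q.2.one_notMem 0
        rwa [zero_mul, pow_zero] at this
      have hsum : u ∉ q.asIdeal ∨ v ∉ q.asIdeal → (∑ i, if p i = q then
          divCoeff D (p i) (a i) Q - divCoeff D (p i) (b i) Q else 0) = 0 := fun h => by
        refine Finset.sum_eq_zero fun i _ => if_neg ?_
        rintro rfl
        exact h.elim (fun h => h (hmem i).1) (fun h => h (hmem i).2)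
      by_cases huq : u ∈ q.asIdeal
      · by_cases hvq : v ∈ q.asIdeal
        · obtain ⟨i, rfl⟩ := hall q hht huq hvq
          refine ⟨a i, b i, (a i).2, (b i).2, ?_, ?_⟩
          · rw [← hn i, ← hm i]
            exact hab' i
          · rw [if_pos huq, if_pos hvq, mul_zero, mul_zero, Finset.sum_eq_single i, if_pos rfl,
              hcoeff _ hq, hcoeff _ hq]
            · ring
            · exact fun j _ hj => if_neg fun h => hj (hinj h)
            · exact fun h => absurd (Finset.mem_univ i) h
        · have hv0 := orderAt_eq_zero hht hvq
          refine ⟨v ^ orderAt q hht u, 1, fun h => hvq (q.2.mem_of_pow_mem _ h), q.2.one_notMem,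
            ?_, ?_⟩
          · rw [hv0, pow_zero, one_mul, mul_one]
          · rw [hsum (Or.inr hvq), if_pos huq, if_neg hvq, hcoeff _ hq, divCoeff_bot D hht u,
              localLength_pow (hcov q hq) hht hvq, hone]
            push_cast
            ring
      · have hu0 := orderAt_eq_zero hht huq
        refine ⟨1, u ^ orderAt q hht v, q.2.one_notMem, fun h => huq (q.2.mem_of_pow_mem _ h),
          ?_, ?_⟩
        · rw [hu0, pow_zero, one_mul, mul_one]
        · rw [hsum (Or.inl huq), if_neg huq, hcoeff _ hq u, divCoeff_bot D hht, divCoeff_bot D hht,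
            hu0, localLength_pow (hcov q hq) hht huq, hone]
          push_cast
          ring
    choose c d hc hd hcd hT using hex
    have hzero := sum_localLength_eq D hu hv hQ
      (fun q hq => ⟨((hS q).mp hq).1, ((hS q).mp hq).2.1⟩)
      (fun q h₁ h₂ h₃ => (hS q).mpr ⟨h₁, h₂, h₃⟩) hc hd hcd
    have htot := Finset.sum_congr (rfl : (Finset.univ : Finset S) = Finset.univ) fun q _ => hT q
    rw [Finset.sum_sub_distrib, Finset.sum_sub_distrib, Finset.sum_sub_distrib,
      ← Nat.cast_sum, ← Nat.cast_sum, hzero, sub_self, Finset.sum_coe_sort S fun q =>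
        divCoeff D ⊥ v q * if u ∈ q.asIdeal then 0 else divCoeff D q u Q,
      Finset.sum_coe_sort S fun q =>
        divCoeff D ⊥ u q * if v ∈ q.asIdeal then 0 else divCoeff D q v Q,
      Finset.sum_coe_sort S fun q =>
        ∑ i, if p i = q then divCoeff D (p i) (a i) Q - divCoeff D (p i) (b i) Q else 0,
      Finset.sum_comm, sub_eq_zero] at htot
    rw [htot]
    refine Finset.sum_congr rfl fun i _ => ?_
    rw [Finset.sum_ite_eq]
    -- A prime `p i` outside `S` is not below `Q`, so its divisors have coefficient zero at `Q`.
    refine (ite_eq_left_iff.mpr fun hi => ?_)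
    have hle : ∀ x, divCoeff D (p i) x Q = 0 := fun x => by
      by_contra h
      exact hi ((hS _).mpr ⟨hp i, le_of_divCoeff_ne_zero h, Or.inl (hmem i).1⟩)
    rw [hle, hle, sub_self]
  · have hcoeff : ∀ q : PrimeSpectrum A, q.asIdeal.height = 1 → ∀ x, divCoeff D q x Q = 0 :=
      fun q hq x => by
        rw [divCoeff, if_neg]
        have := hdim q hq
        omega
    rw [Finset.sum_eq_zero fun q hq => ?_, Finset.sum_eq_zero fun q hq => ?_,
      Finset.sum_eq_zero fun i _ => ?_, sub_self]
    · rw [hcoeff _ (hp i), hcoeff _ (hp i), sub_self]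
    · rw [hcoeff _ ((hS q).mp hq).1, ite_self, mul_zero]
    · rw [hcoeff _ ((hS q).mp hq).1, ite_self, mul_zero]

end Dimension

end CycleIntersection

theorem theorem3p1 {A : Type*} [CommRing A] [IsDomain A] [IsNoetherianRing A]
    [IsIntegrallyClosed A] (D : CycleIntersection.DimensionTheory A)
    (u v : A) (hu : u ≠ 0) (hv : v ≠ 0)
    (r : ℕ) (p : Fin r → PrimeSpectrum A) (hinj : Function.Injective p)
    (hp : ∀ i, (p i).asIdeal.height = 1)
    (hmem : ∀ i, u ∈ (p i).asIdeal ∧ v ∈ (p i).asIdeal)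
    (hall : ∀ q : PrimeSpectrum A, q.asIdeal.height = 1 → u ∈ q.asIdeal → v ∈ q.asIdeal →
      ∃ i, p i = q)
    (n m : Fin r → ℕ)
    (hn : ∀ i, n i = CycleIntersection.orderAt (p i) (hp i) u)
    (hm : ∀ i, m i = CycleIntersection.orderAt (p i) (hp i) v)
    (a b : ∀ i, (p i).asIdeal.primeCompl)
    (hab : ∀ i, algebraMap A (FractionRing A) (a i : A) / algebraMap A (FractionRing A) (b i : A) =
      algebraMap A (FractionRing A) v ^ n i / algebraMap A (FractionRing A) u ^ m i) :
    CycleIntersection.cap D u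
        (CycleIntersection.cap D v (CycleIntersection.fundamentalCycle A)) -
      CycleIntersection.cap D v
        (CycleIntersection.cap D u (CycleIntersection.fundamentalCycle A)) =
      ∑ i, CycleIntersection.divFrac D (p i) (a i) (b i) :=
  CycleIntersection.cap_cap_sub_cap_cap D u v hu hv r p hinj hp hmem hall n m hn hm a b hab
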